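/- Let $d \ge 2$ be an integer and let $K \subseteq \mathbb{R}^d$ be a convex body (a compact convex set with nonempty interior) with $d$-dimensional Lebesgue measure $\lambda_d(K)=1$. Let $n \ge 0$ be an integer and let $S$ be a set of $n$ points chosen independently and uniformly at random from $K$. A set $H \subseteq S$ of $k$ points is called a $k$-hole in $S$ if $H$ is in convex position and the interior of the convex hull of $H$ contains no point of $S$. Then the expected number $EH^K_{d,d+1}(n)$ of $(d+1)$-holes in $S$ (also called empty simplices) satisfies \[ EH^K_{d,d+1}(n) \le 2^{d-1}\cdot d!\cdot \binom{n}{d}. \] -/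

import Mathlib

open MeasureTheory ProbabilityTheory

/-- `H` is a `k`-hole in the finite point set `S`: `H` consists of `k` points of `S`, is in convex
position, and the interior of its convex hull contains no point of `S`. -/
def IsHole {d : ℕ} (k : ℕ) (S H : Finset (EuclideanSpace ℝ (Fin d))) : Prop :=
  H ⊆ S ∧ H.card = k ∧
    ConvexIndependent ℝ (fun x : H => (x : EuclideanSpace ℝ (Fin d))) ∧
    ∀ p ∈ S, p ∉ interior (convexHull ℝ (H : Set (EuclideanSpace ℝ (Fin d))))

open Classical in
/-- The number of `k`-holes in the finite point set `S`. -/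
noncomputable def numHoles {d : ℕ} (k : ℕ) (S : Finset (EuclideanSpace ℝ (Fin d))) : ℕ :=
  (S.powerset.filter (fun H => IsHole k S H)).card

open Classical in
/-- The finite set of points `{x 0, …, x (n - 1)}`. -/
noncomputable def pointSet {d n : ℕ} (x : Fin n → EuclideanSpace ℝ (Fin d)) :
    Finset (EuclideanSpace ℝ (Fin d)) :=
  Finset.univ.image x

/-- A convex body in `ℝ^d`: a compact convex set with nonempty interior. -/
structure IsConvexBody {d : ℕ} (K : Set (EuclideanSpace ℝ (Fin d))) : Prop where
  isCompact : IsCompact K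
  convex : Convex ℝ K
  interior_nonempty : (interior K).Nonempty

/-- The `j`-th coordinate of `z`, with value `0` for `j ≥ d`. -/
def coord {d : ℕ} (z : EuclideanSpace ℝ (Fin d)) (j : ℕ) : ℝ :=
  if h : j < d then z ⟨j, h⟩ else 0

/-- The determinant of the first `k` coordinates of the vectors `q 1 - q 0, …, q k - q 0`. -/
noncomputable def leadDet {d : ℕ} (q : ℕ → EuclideanSpace ℝ (Fin d)) (k : ℕ) : ℝ :=
  Matrix.det (Matrix.of fun a b : Fin k => coord (q (a + 1)) b - coord (q 0) b)

/-- The quantity that the `k`-th point of a greedy ordering maximises. -/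
noncomputable def greedyVal {d : ℕ} (p : ℕ → EuclideanSpace ℝ (Fin d)) (k : ℕ)
    (z : EuclideanSpace ℝ (Fin d)) : ℝ :=
  if k = 0 then -coord z 0 else |leadDet (Function.update p k z) k|

section Determinants

variable {d : ℕ}

theorem coord_apply (z : EuclideanSpace ℝ (Fin d)) (j : Fin d) : coord z j = z j := by
  simp [coord]

theorem continuous_coord (j : ℕ) :
    Continuous fun z : EuclideanSpace ℝ (Fin d) => coord z j := by
  unfold coord
  split_ifs <;> fun_prop

@[simp] theorem leadDet_zero (q : ℕ → EuclideanSpace ℝ (Fin d)) : leadDet q 0 = 1 := by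
  simp [leadDet]

theorem leadDet_congr {p q : ℕ → EuclideanSpace ℝ (Fin d)} {k : ℕ} (h : ∀ i ≤ k, p i = q i) :
    leadDet p k = leadDet q k := by
  unfold leadDet
  congr 1
  ext a b
  simp only [Matrix.of_apply]
  rw [h 0 (Nat.zero_le _), h (a + 1) (by omega)]

theorem continuous_leadDet (k : ℕ) :
    Continuous fun q : ℕ → EuclideanSpace ℝ (Fin d) => leadDet q k := by
  unfold leadDet
  refine Continuous.matrix_det (continuous_matrix fun a b => ?_)
  exact ((continuous_coord b).comp (continuous_apply ((a : ℕ) + 1))).sub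
    ((continuous_coord b).comp (continuous_apply 0))

theorem greedyVal_congr {p q : ℕ → EuclideanSpace ℝ (Fin d)} {k : ℕ} (h : ∀ i < k, p i = q i)
    (z : EuclideanSpace ℝ (Fin d)) : greedyVal p k z = greedyVal q k z := by
  unfold greedyVal
  split_ifs with hk
  · rfl
  · congr 1
    refine leadDet_congr fun i hi => ?_
    rcases eq_or_ne i k with rfl | hik
    · simp
    · simp [hik, h i (by omega)]

theorem continuous_greedyVal (k : ℕ) : Continuous
    fun w : (ℕ → EuclideanSpace ℝ (Fin d)) × EuclideanSpace ℝ (Fin d) => greedyVal w.1 k w.2 := by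
  unfold greedyVal
  split_ifs
  · exact ((continuous_coord 0).comp continuous_snd).neg
  · exact ((continuous_leadDet k).comp (continuous_fst.update k continuous_snd)).abs

theorem leadDet_update_succ (p : ℕ → EuclideanSpace ℝ (Fin d)) (k : ℕ) :
    ∃ c : ℕ → ℝ, c k = leadDet p k ∧
      ∀ z, leadDet (Function.update p (k + 1) z) (k + 1) =
        ∑ j ∈ Finset.range (k + 1), c j * (coord z j - coord (p 0) j) := by
  suffices h : ∃ c : Fin (k + 1) → ℝ, c (Fin.last k) = leadDet p k ∧
      ∀ z, leadDet (Function.update p (k + 1) z) (k + 1) =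
        ∑ j, c j * (coord z j - coord (p 0) j) by
    obtain ⟨c, hc, hz⟩ := h
    refine ⟨fun j => if h : j < k + 1 then c ⟨j, h⟩ else 0, by simpa [Fin.last] using hc,
      fun z => ?_⟩
    rw [hz, ← Fin.sum_univ_eq_sum_range
      (fun j => (if h : j < k + 1 then c ⟨j, h⟩ else 0) * (coord z j - coord (p 0) j))]
    refine Finset.sum_congr rfl fun x _ => ?_
    simp [Nat.lt_succ_iff.1 x.2]
  let A : Matrix (Fin (k + 1)) (Fin (k + 1)) ℝ :=
    Matrix.of fun a b => coord (p (a + 1)) b - coord (p 0) b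
  refine ⟨fun j => (-1) ^ ((Fin.last k : ℕ) + (j : ℕ)) *
    (A.submatrix (Fin.last k).succAbove j.succAbove).det, ?_, fun z => ?_⟩
  · have h1 : ((-1 : ℝ)) ^ (k + k) = 1 := Even.neg_one_pow ⟨k, rfl⟩
    simp only [Fin.val_last, h1, one_mul]
    unfold leadDet
    congr 1
    ext a b
    simp [A]
  · rw [leadDet, Matrix.det_succ_row _ (Fin.last k)]
    refine Finset.sum_congr rfl fun j _ => ?_
    have h2 : ((Matrix.of fun a b : Fin (k + 1) =>
        coord (Function.update p (k + 1) z (a + 1)) b -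
          coord (Function.update p (k + 1) z 0) b).submatrix (Fin.last k).succAbove j.succAbove) =
        A.submatrix (Fin.last k).succAbove j.succAbove := by
      ext a b
      have : (a : ℕ) ≠ k := a.2.ne
      simp [A, this]
    rw [h2]
    simp
    ring

end Determinants

section Volumes

theorem volume_triangular_box {d : ℕ} (L : Matrix (Fin d) (Fin d) ℝ)
    (hL : ∀ i j, i < j → L i j = 0) (hdiag : ∀ i, L i i ≠ 0) (lo hi : Fin d → ℝ) :
    volume {z : Fin d → ℝ | ∀ i, L.mulVec z i ∈ Set.Icc (lo i) (hi i)} =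
      ENNReal.ofReal |(∏ i, L i i)⁻¹| * ∏ i, ENNReal.ofReal (hi i - lo i) := by
  have hdet : L.det = ∏ i, L i i := Matrix.det_of_isLowerTriangular L fun i j h => hL i j h
  have hdet' : LinearMap.det (Matrix.toLin' L) = ∏ i, L i i := by
    rw [LinearMap.det_toLin', hdet]
  have h0 : LinearMap.det (Matrix.toLin' L) ≠ 0 := by
    rw [hdet']
    exact Finset.prod_ne_zero_iff.2 fun i _ => hdiag i
  have := Measure.addHaar_preimage_linearMap (volume : Measure (Fin d → ℝ)) h0 (Set.Icc lo hi)
  rw [hdet', Real.volume_Icc_pi] at this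
  rw [← this]
  congr 1
  ext z
  simp [Set.mem_Icc, Pi.le_def, forall_and]

theorem one_le_factorial_mul_volume_corner (d : ℕ) :
    1 ≤ (d.factorial : ENNReal) * volume {y : Fin d → ℝ | (∀ i, 0 ≤ y i) ∧ ∑ i, y i ≤ 1} := by
  rcases Nat.eq_zero_or_pos d with rfl | hd
  · have : {y : Fin 0 → ℝ | (∀ i, 0 ≤ y i) ∧ ∑ i, y i ≤ 1} = Set.univ := by
      ext y; simp
    rw [this]
    simp [volume_pi]
  have : Nonempty (Fin d) := ⟨⟨0, hd⟩⟩
  set D := {y : Fin d → ℝ | (∀ i, 0 ≤ y i) ∧ ∑ i, y i ≤ 1} with hD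
  have hball : volume {x : Fin d → ℝ | ∑ i, |x i| ≤ 1} =
      ENNReal.ofReal (2 ^ d / d.factorial) := by
    have := volume_sum_rpow_le (ι := Fin d) (p := 1) le_rfl 1
    simp only [Real.rpow_one, div_one, ENNReal.ofReal_one, one_pow, one_mul, Fintype.card_fin,
      Real.Gamma_nat_eq_factorial] at this
    rw [this]
    norm_num [Real.Gamma_two]
  have hcover : {x : Fin d → ℝ | ∑ i, |x i| ≤ 1} ⊆
      ⋃ e : Fin d → Bool, {x : Fin d → ℝ | (Matrix.diagonal
        (fun i => if e i then (1 : ℝ) else -1)).mulVec x ∈ D} := by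
    intro x hx
    simp only [Set.mem_iUnion]
    refine ⟨fun i => decide (0 ≤ x i), ?_⟩
    have key : (Matrix.diagonal (fun i => if decide (0 ≤ x i) then (1 : ℝ) else -1)).mulVec x
        = fun i => |x i| := by
      ext i
      rw [Matrix.mulVec_diagonal]
      by_cases h : 0 ≤ x i
      · simp [h, abs_of_nonneg h]
      · simp [h, abs_of_neg (not_le.1 h)]
    simp only [Set.mem_ofPred_eq]
    rw [key]
    exact ⟨fun i => abs_nonneg _, hx⟩
  have hpiece : ∀ e : Fin d → Bool, volume {x : Fin d → ℝ | (Matrix.diagonal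
        (fun i => if e i then (1 : ℝ) else -1)).mulVec x ∈ D} = volume D := by
    intro e
    have hdet : |LinearMap.det (Matrix.toLin' (Matrix.diagonal
        (fun i => if e i then (1 : ℝ) else -1)))| = 1 := by
      rw [LinearMap.det_toLin', Matrix.det_diagonal, Finset.abs_prod]
      refine Finset.prod_eq_one fun i _ => ?_
      split_ifs <;> simp
    have h0 : LinearMap.det (Matrix.toLin' (Matrix.diagonal
        (fun i => if e i then (1 : ℝ) else -1))) ≠ 0 := by
      intro h
      rw [h] at hdet
      simp at hdet
    have := Measure.addHaar_preimage_linearMap (volume : Measure (Fin d → ℝ)) h0 D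
    rw [abs_inv, hdet, inv_one, ENNReal.ofReal_one, one_mul] at this
    exact this
  have hle := (measure_mono hcover).trans (measure_iUnion_le (μ := volume) _)
  rw [hball] at hle
  simp only [hpiece, tsum_fintype, Finset.sum_const, Finset.card_univ, Fintype.card_fun,
    Fintype.card_bool, Fintype.card_fin, nsmul_eq_mul] at hle
  have hf : (0 : ℝ) < d.factorial := by positivity
  rw [ENNReal.ofReal_div_of_pos hf, ENNReal.ofReal_natCast, ENNReal.ofReal_pow (by norm_num),
    ENNReal.ofReal_ofNat] at hle
  push_cast at hle
  have h2 : (2 : ENNReal) ^ d ≠ 0 := by positivity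
  have h2' : (2 : ENNReal) ^ d ≠ ⊤ := by simp
  have hf0 : (d.factorial : ENNReal) ≠ 0 := by exact_mod_cast d.factorial_ne_zero
  rw [ENNReal.div_le_iff hf0 (by simp)] at hle
  rw [mul_assoc] at hle
  have := (ENNReal.mul_le_mul_iff_right h2 h2' (a := 2 ^ d) (b := 1) (c := volume D * d.factorial)).1
    (by simpa using hle)
  rwa [mul_comm]

variable {d : ℕ}

theorem ofReal_abs_leadDet_le (q : ℕ → EuclideanSpace ℝ (Fin d)) :
    ENNReal.ofReal (|leadDet q d| / d.factorial) ≤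
      volume (interior (convexHull ℝ (q '' Set.Iic d))) := by
  set D := {y : Fin d → ℝ | (∀ i, 0 ≤ y i) ∧ ∑ i, y i ≤ 1} with hD
  let A : Matrix (Fin d) (Fin d) ℝ := Matrix.of fun a b => coord (q (a + 1)) b - coord (q 0) b
  have hconv : Convex ℝ (convexHull ℝ (q '' Set.Iic d)) := convex_convexHull _ _
  have hint : volume (interior (convexHull ℝ (q '' Set.Iic d))) =
      volume (convexHull ℝ (q '' Set.Iic d)) :=
    measure_congr (interior_ae_eq_of_null_frontier (hconv.addHaar_frontier _))
  rw [hint]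
  have hdet : LinearMap.det (Matrix.toLin' A.transpose) = leadDet q d := by
    rw [LinearMap.det_toLin', Matrix.det_transpose]; rfl
  have himg : volume (Matrix.toLin' A.transpose '' D) = ENNReal.ofReal |leadDet q d| * volume D := by
    rw [Measure.addHaar_image_linearMap, hdet]
  have hsub : Matrix.toLin' A.transpose '' D ⊆
      (fun w => WithLp.toLp 2 w + q 0) ⁻¹' (convexHull ℝ (q '' Set.Iic d)) := by
    rintro _ ⟨y, ⟨hy0, hy1⟩, rfl⟩
    have hmem : ∀ i ≤ d, q i ∈ convexHull ℝ (q '' Set.Iic d) := fun i hi =>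
      subset_convexHull _ _ ⟨i, hi, rfl⟩
    have hcomb : WithLp.toLp 2 (Matrix.toLin' A.transpose y) + q 0 =
        ∑ i : Option (Fin d), (i.elim (1 - ∑ i, y i) y) • (i.elim (q 0) fun a => q (a + 1)) := by
      rw [Fintype.sum_option]
      ext b
      simp [Matrix.mulVec, dotProduct, A, coord_apply, sub_mul, Finset.sum_mul, mul_comm, mul_sub]
      ring
    simp only [Set.mem_preimage]
    rw [hcomb]
    refine hconv.sum_mem ?_ ?_ ?_
    · rintro (_ | i) _
      · simpa using hy1
      · exact hy0 i
    · rw [Fintype.sum_option]; simp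
    · rintro (_ | i) _
      · exact hmem 0 (Nat.zero_le _)
      · exact hmem _ i.2
  have hmp : MeasurePreserving (fun w : Fin d → ℝ => (WithLp.toLp 2 w : EuclideanSpace ℝ (Fin d)) + q 0) :=
    (measurePreserving_add_right volume (q 0)).comp (PiLp.volume_preserving_toLp (Fin d))
  have hle := measure_mono (μ := volume) hsub
  rw [hmp.measure_preimage (hconv.nullMeasurableSet volume), himg] at hle
  refine le_trans ?_ hle
  have hf : (0 : ℝ) < d.factorial := by positivity
  rw [ENNReal.ofReal_div_of_pos hf, ENNReal.ofReal_natCast]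
  refine ENNReal.div_le_of_le_mul ?_
  calc ENNReal.ofReal |leadDet q d| = ENNReal.ofReal |leadDet q d| * 1 := (mul_one _).symm
    _ ≤ ENNReal.ofReal |leadDet q d| * (d.factorial * volume D) := by
        gcongr; exact one_le_factorial_mul_volume_corner d
    _ = _ := by ring

theorem volume_greedy_region_le (hd : 0 < d) (p : ℕ → EuclideanSpace ℝ (Fin d))
    (hp : ∀ k < d, leadDet p k ≠ 0) {r : ℝ} (hr : 0 ≤ r) :
    volume {z : EuclideanSpace ℝ (Fin d) | (∀ k < d, greedyVal p k z ≤ greedyVal p k (p k)) ∧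
      |leadDet (Function.update p d z) d| ≤ r} ≤ ENNReal.ofReal (2 ^ (d - 1) * r) := by
  choose c hc1 hc2 using leadDet_update_succ p
  let L : Matrix (Fin d) (Fin d) ℝ := Matrix.of fun i j => if j ≤ i then c i j else 0
  let B : ℕ → ℝ := fun k => if k = d then r else |leadDet p k|
  let v : Fin d → ℝ := L.mulVec fun j => p 0 j
  let lo : Fin d → ℝ := fun i => v i - if (i : ℕ) = 0 then 0 else B (i + 1)
  let hi : Fin d → ℝ := fun i => v i + B (i + 1)
  have hL (z : EuclideanSpace ℝ (Fin d)) (i : Fin d) :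
      L.mulVec (fun j => z j) i = v i + leadDet (Function.update p (i + 1) z) (i + 1) := by
    have h1 : L.mulVec (fun j => z j) i - v i =
        ∑ j : Fin d, (if (j : ℕ) ≤ i then c i j else 0) * (coord z j - coord (p 0) j) := by
      simp only [v, Matrix.mulVec, dotProduct, ← Finset.sum_sub_distrib, coord_apply, mul_sub]
      rfl
    rw [Fin.sum_univ_eq_sum_range
      (fun j => (if j ≤ (i : ℕ) then c i j else 0) * (coord z j - coord (p 0) j)),
      ← Finset.sum_subset (Finset.range_subset_range.2 (by omega : (i : ℕ) + 1 ≤ d))] at h1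
    · rw [hc2, ← sub_eq_iff_eq_add', h1]
      refine Finset.sum_congr rfl fun j hj => ?_
      rw [if_pos (Nat.lt_succ_iff.1 (Finset.mem_range.1 hj))]
    · intro j _ hj
      rw [if_neg (by simpa using hj), zero_mul]
  have hdiag (i : Fin d) : L i i = leadDet p i := by simp [L, hc1]
  have hsub : {z : EuclideanSpace ℝ (Fin d) |
      (∀ k < d, greedyVal p k z ≤ greedyVal p k (p k)) ∧
      |leadDet (Function.update p d z) d| ≤ r} ⊆ WithLp.ofLp ⁻¹'
        {z : Fin d → ℝ | ∀ i, L.mulVec z i ∈ Set.Icc (lo i) (hi i)} := by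
    rintro z ⟨hz, hzr⟩ i
    have hbd : |leadDet (Function.update p (i + 1) z) (i + 1)| ≤ B (i + 1) := by
      by_cases h : (i : ℕ) + 1 = d
      · simp only [B, if_pos h]
        rwa [h]
      · have := hz (i + 1) (by omega)
        simpa [greedyVal, B, h] using this
    have hmv : L.mulVec z.ofLp i = v i + leadDet (Function.update p (i + 1) z) (i + 1) := hL z i
    simp only [Set.mem_Icc, hmv, lo, hi]
    refine ⟨?_, by linarith [(abs_le.1 hbd).2]⟩
    split_ifs with h0
    · have := hz 0 hd
      simp only [greedyVal, if_true] at this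
      rw [h0]
      simp [leadDet]
      linarith
    · linarith [(abs_le.1 hbd).1]
  refine (measure_mono hsub).trans ?_
  have hbox : MeasurableSet {z : Fin d → ℝ | ∀ i, L.mulVec z i ∈ Set.Icc (lo i) (hi i)} := by
    have : {z : Fin d → ℝ | ∀ i, L.mulVec z i ∈ Set.Icc (lo i) (hi i)} =
        Matrix.toLin' L ⁻¹' Set.Icc lo hi := by
      ext z
      simp [Set.mem_Icc, Pi.le_def, forall_and]
    rw [this]
    exact (Matrix.toLin' L).continuous_of_finiteDimensional.measurable measurableSet_Icc
  rw [(PiLp.volume_preserving_ofLp (Fin d)).measure_preimage hbox.nullMeasurableSet,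
    volume_triangular_box L (fun i j h => by simp [L, h]) (fun i => by rw [hdiag]; exact hp i i.2)]
  have hB0 (k : ℕ) : 0 ≤ B k := by
    simp only [B]; split_ifs <;> positivity
  have hBpos : 0 < ∏ i ∈ Finset.range d, B i := by
    refine Finset.prod_pos fun i hi => ?_
    have := Finset.mem_range.1 hi
    simpa [B, this.ne] using hp i this
  have hprodL : |(∏ i, L i i)⁻¹| = (∏ i ∈ Finset.range d, B i)⁻¹ := by
    rw [abs_inv, Finset.abs_prod, ← Fin.prod_univ_eq_prod_range]
    congr 1
    refine Finset.prod_congr rfl fun i _ => ?_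
    simp [hdiag, B, i.2.ne]
  have hlen : ∏ i, ENNReal.ofReal (hi i - lo i) =
      ENNReal.ofReal (2 ^ (d - 1) * ∏ i ∈ Finset.range d, B (i + 1)) := by
    rw [← ENNReal.ofReal_prod_of_nonneg]
    · congr 1
      have : ∀ i, hi i - lo i = (if (i : ℕ) = 0 then 1 else 2) * B (i + 1) := by
        intro i
        simp only [hi, lo]
        split_ifs <;> ring
      simp only [this]
      rw [Finset.prod_mul_distrib, Fin.prod_univ_eq_prod_range (fun i => B (i + 1)),
        Fin.prod_univ_eq_prod_range (fun i => if i = 0 then (1 : ℝ) else 2)]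
      obtain ⟨e, rfl⟩ := Nat.exists_eq_succ_of_ne_zero hd.ne'
      simp [Finset.prod_range_succ']
    · intro i _
      simp only [hi, lo]
      split_ifs <;> linarith [hB0 (i + 1)]
  rw [hprodL, hlen, ← ENNReal.ofReal_mul (by positivity)]
  refine ENNReal.ofReal_le_ofReal (le_of_eq ?_)
  have htel : (∏ i ∈ Finset.range d, B (i + 1)) = (∏ i ∈ Finset.range d, B i) * r := by
    have h := (Finset.prod_range_succ B d).symm.trans (Finset.prod_range_succ' B d)
    have h0 : B 0 = 1 := by simp [B, hd.ne]
    have hdr : B d = r := by simp [B]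
    rw [h0, hdr, mul_one] at h
    exact h.symm
  rw [htel]
  field_simp

end Volumes

section Measurability

variable {d : ℕ} {ι : Type*}

theorem convexHull_image_finset_eq (x : ι → EuclideanSpace ℝ (Fin d)) (A : Finset ι) :
    convexHull ℝ (x '' A) = {z | ∃ w ∈ stdSimplex ℝ A, ∑ i, w i • x i = z} := by
  have h : x '' A = Set.range fun i : A => x i := by
    ext z; simp
  have h2 : convexHull ℝ (Set.range fun i : A => x i) =
      Fintype.linearCombination ℝ (fun i : A => x i) '' stdSimplex ℝ A := by
    classical
    rw [← convexHull_rangle_single_eq_stdSimplex, LinearMap.image_convexHull, ← Set.range_comp]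
    congr 2
    ext1 i
    simp [Fintype.linearCombination_apply_single]
  rw [h, h2]
  rfl

theorem isClosed_mem_convexHull_image (A : Finset ι) :
    IsClosed {u : (ι → EuclideanSpace ℝ (Fin d)) × EuclideanSpace ℝ (Fin d) |
      u.2 ∈ convexHull ℝ (u.1 '' A)} := by
  have hK : CompactSpace (stdSimplex ℝ A) := isCompact_iff_compactSpace.1 (isCompact_stdSimplex _ _)
  let C : Set (stdSimplex ℝ A × ((ι → EuclideanSpace ℝ (Fin d)) × EuclideanSpace ℝ (Fin d))) :=
    {v | ∑ i, (v.1 : A → ℝ) i • v.2.1 i = v.2.2}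
  have hC : IsClosed C := by
    refine isClosed_eq ?_ (by fun_prop)
    refine continuous_finsetSum _ fun i _ => ?_
    exact ((continuous_apply i).comp (continuous_subtype_val.comp continuous_fst)).smul
      ((continuous_apply (i : ι)).comp (continuous_fst.comp continuous_snd))
  have himg : {u : (ι → EuclideanSpace ℝ (Fin d)) × EuclideanSpace ℝ (Fin d) |
      u.2 ∈ convexHull ℝ (u.1 '' A)} = Prod.snd '' C := by
    ext u
    simp only [convexHull_image_finset_eq, C, Set.mem_ofPred_eq, Set.mem_image]
    constructor
    · rintro ⟨w, hw, h⟩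
      exact ⟨(⟨w, hw⟩, u), h, rfl⟩
    · rintro ⟨v, h, rfl⟩
      exact ⟨v.1, v.1.2, h⟩
  rw [himg]
  exact isClosedMap_snd_of_compactSpace _ hC

theorem measurableSet_mem_interior_convexHull_image [Countable ι] (A : Finset ι) :
    MeasurableSet {u : (ι → EuclideanSpace ℝ (Fin d)) × EuclideanSpace ℝ (Fin d) |
      u.2 ∈ interior (convexHull ℝ (u.1 '' A))} := by
  let b := TopologicalSpace.countableBasis (EuclideanSpace ℝ (Fin d))
  have hb := TopologicalSpace.isBasis_countableBasis (EuclideanSpace ℝ (Fin d))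
  have hset : {u : (ι → EuclideanSpace ℝ (Fin d)) × EuclideanSpace ℝ (Fin d) |
      u.2 ∈ interior (convexHull ℝ (u.1 '' A))} =
      ⋃ U ∈ b, {x | U ⊆ convexHull ℝ (x '' A)} ×ˢ U := by
    ext u
    simp only [Set.mem_ofPred_eq, Set.mem_iUnion, Set.mem_prod, exists_prop, mem_interior_iff_mem_nhds,
      hb.mem_nhds_iff, b]
    exact exists_congr fun U => by tauto
  rw [hset]
  refine MeasurableSet.biUnion (TopologicalSpace.countable_countableBasis _) fun U hU => ?_
  refine MeasurableSet.prod ?_ (hb.isOpen hU).measurableSet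
  have : {x : ι → EuclideanSpace ℝ (Fin d) | U ⊆ convexHull ℝ (x '' A)} =
      ⋂ z ∈ U, (fun x => (x, z)) ⁻¹' {u | u.2 ∈ convexHull ℝ (u.1 '' A)} := by
    ext x; simp [Set.subset_def]
  rw [this]
  refine (isClosed_biInter fun z _ => ?_).measurableSet
  exact (isClosed_mem_convexHull_image A).preimage (by fun_prop)

theorem measurableSet_apply_mem_interior_convexHull_image [Countable ι] (A : Finset ι) (i : ι) :
    MeasurableSet {x : ι → EuclideanSpace ℝ (Fin d) |
      x i ∈ interior (convexHull ℝ (x '' A))} :=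
  (measurable_id.prodMk (measurable_pi_apply i)) (measurableSet_mem_interior_convexHull_image A)

theorem measurableSet_apply_mem_convexHull_image [Countable ι] (A : Finset ι) (i : ι) :
    MeasurableSet {x : ι → EuclideanSpace ℝ (Fin d) | x i ∈ convexHull ℝ (x '' A)} :=
  (measurable_id.prodMk (measurable_pi_apply i)) (isClosed_mem_convexHull_image A).measurableSet

theorem isHole_image_iff {n : ℕ} {x : Fin n → EuclideanSpace ℝ (Fin d)}
    (hx : Function.Injective x) (k : ℕ) (T : Finset (Fin n)) :
    IsHole k (pointSet x) (T.map ⟨x, hx⟩) ↔ T.card = k ∧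
      (∀ i ∈ T, x i ∉ convexHull ℝ (x '' (T.erase i))) ∧
      ∀ i, x i ∉ interior (convexHull ℝ (x '' T)) := by
  have h1 : T.map ⟨x, hx⟩ ⊆ pointSet x := by
    intro z hz
    obtain ⟨i, _, rfl⟩ := Finset.mem_map.1 hz
    exact Finset.mem_image_of_mem x (Finset.mem_univ i)
  have h2 : ((T.map ⟨x, hx⟩ : Finset _) : Set (EuclideanSpace ℝ (Fin d))) = x '' T := by simp
  have h3 : ConvexIndependent ℝ (fun y : (T.map ⟨x, hx⟩ : Finset _) =>
      (y : EuclideanSpace ℝ (Fin d))) ↔ ∀ i ∈ T, x i ∉ convexHull ℝ (x '' (T.erase i)) := by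
    have := convexIndependent_set_iff_notMem_convexHull_sdiff (𝕜 := ℝ)
      (s := ((T.map ⟨x, hx⟩ : Finset _) : Set (EuclideanSpace ℝ (Fin d))))
    refine this.trans ?_
    rw [h2, Set.forall_mem_image]
    refine forall₂_congr fun i hi => ?_
    rw [Finset.coe_erase, Set.image_sdiff hx, Set.image_singleton]
  unfold IsHole
  have h4 : (∀ p ∈ pointSet x, p ∉ interior (convexHull ℝ (x '' T))) ↔
      ∀ i, x i ∉ interior (convexHull ℝ (x '' T)) := by
    simp [pointSet]
  rw [h3, h2, h4, and_iff_right h1, Finset.card_map]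

open Classical in
theorem numHoles_pointSet_eq {n : ℕ} {x : Fin n → EuclideanSpace ℝ (Fin d)}
    (hx : Function.Injective x) (k : ℕ) :
    numHoles k (pointSet x) = (Finset.univ.filter fun T : Finset (Fin n) => T.card = k ∧
      (∀ i ∈ T, x i ∉ convexHull ℝ (x '' (T.erase i))) ∧
      ∀ i, x i ∉ interior (convexHull ℝ (x '' T))).card := by
  unfold numHoles
  symm
  refine Finset.card_bij (fun T _ => T.map ⟨x, hx⟩) ?_ ?_ ?_
  · intro T hT
    have := (isHole_image_iff hx k T).2 (Finset.mem_filter.1 hT).2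
    exact Finset.mem_filter.2 ⟨Finset.mem_powerset.2 this.1, this⟩
  · intro T _ T' _ h
    exact Finset.map_injective _ h
  · intro H hH
    obtain ⟨hH1, hH2⟩ := Finset.mem_filter.1 hH
    obtain ⟨T, -, hT⟩ := Finset.subset_image_iff.1 (Finset.mem_powerset.1 hH1)
    have hT' : T.map ⟨x, hx⟩ = H := by rw [← hT, Finset.map_eq_image]; rfl
    refine ⟨T, Finset.mem_filter.2 ⟨Finset.mem_univ _, (isHole_image_iff hx k T).1 ?_⟩, hT'⟩
    rwa [hT']

theorem aemeasurable_numHoles_pointSet {n : ℕ} (k : ℕ)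
    {π : Measure (Fin n → EuclideanSpace ℝ (Fin d))} (hπ : ∀ᵐ x ∂π, Function.Injective x) :
    AEMeasurable (fun x => (numHoles k (pointSet x) : ℝ)) π := by
  classical
  let S : Finset (Fin n) → Set (Fin n → EuclideanSpace ℝ (Fin d)) := fun T =>
    {x | T.card = k ∧ (∀ i ∈ T, x i ∉ convexHull ℝ (x '' (T.erase i))) ∧
      ∀ i, x i ∉ interior (convexHull ℝ (x '' T))}
  have hS : ∀ T, MeasurableSet (S T) := by
    intro T
    refine (MeasurableSet.const _).inter (MeasurableSet.inter ?_ ?_)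
    · refine MeasurableSet.congr (s := ⋂ i ∈ T, {x | x i ∉ convexHull ℝ (x '' (T.erase i))}) ?_
        (by ext; simp only [Set.mem_iInter]; rfl)
      exact MeasurableSet.biInter (Set.to_countable _) fun i _ =>
        (measurableSet_apply_mem_convexHull_image _ i).compl
    · refine MeasurableSet.congr (s := ⋂ i, {x | x i ∉ interior (convexHull ℝ (x '' T))}) ?_
        (by ext; simp only [Set.mem_iInter]; rfl)
      exact MeasurableSet.iInter fun i =>
        (measurableSet_apply_mem_interior_convexHull_image _ i).compl
  refine ⟨fun x => ∑ T, (S T).indicator (fun _ => (1 : ℝ)) x,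
    Finset.measurable_sum _ fun T _ => measurable_const.indicator (hS T), ?_⟩
  filter_upwards [hπ] with x hx
  rw [numHoles_pointSet_eq hx, Finset.card_filter]
  simp only [Nat.cast_sum, Nat.cast_ite, Nat.cast_one, Nat.cast_zero, Set.indicator_apply, S,
    Set.mem_ofPred_eq]

end Measurability

section ProductMeasure

variable {ι α : Type*} [Fintype ι] [DecidableEq ι] [MeasurableSpace α]
  (μ : Measure α) [IsProbabilityMeasure μ]

theorem measurePreserving_finset_piecewise (F : Finset ι) :
    MeasurePreserving (fun u : (ι → α) × (ι → α) => F.piecewise u.1 u.2)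
      ((Measure.pi fun _ => μ).prod (Measure.pi fun _ => μ)) (Measure.pi fun _ => μ) := by
  have hm : Measurable fun u : (ι → α) × (ι → α) => F.piecewise u.1 u.2 := by
    refine measurable_pi_iff.2 fun i => ?_
    by_cases hi : i ∈ F
    · simpa [hi, Function.comp_def] using (measurable_pi_apply i).comp measurable_fst
    · simpa [hi, Function.comp_def] using (measurable_pi_apply i).comp measurable_snd
  refine ⟨hm, (Measure.pi_eq fun s hs => ?_).symm⟩
  rw [Measure.map_apply hm (MeasurableSet.univ_pi hs)]
  have hpre : (fun u : (ι → α) × (ι → α) => F.piecewise u.1 u.2) ⁻¹' Set.univ.pi s =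
      Set.univ.pi (fun i => if i ∈ F then s i else Set.univ) ×ˢ
        Set.univ.pi (fun i => if i ∈ F then Set.univ else s i) := by
    ext u
    simp only [Set.mem_preimage, Set.mem_pi, Set.mem_univ, true_imp_iff, Set.mem_prod,
      ← forall_and]
    refine forall_congr' fun i => ?_
    by_cases hi : i ∈ F <;> simp [hi]
  rw [hpre, Measure.prod_prod, Measure.pi_pi, Measure.pi_pi, ← Finset.prod_mul_distrib]
  refine Finset.prod_congr rfl fun i _ => ?_
  split_ifs <;> simp

theorem measurePreserving_update (j : ι) :
    MeasurePreserving (fun u : α × (ι → α) => Function.update u.2 j u.1)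
      (μ.prod (Measure.pi fun _ => μ)) (Measure.pi fun _ => μ) := by
  have hm : Measurable fun u : α × (ι → α) => Function.update u.2 j u.1 := by
    refine measurable_pi_iff.2 fun i => ?_
    by_cases hi : i = j
    · subst hi
      simpa using measurable_fst
    · simpa [hi, Function.comp_def] using (measurable_pi_apply i).comp measurable_snd
  refine ⟨hm, (Measure.pi_eq fun s hs => ?_).symm⟩
  rw [Measure.map_apply hm (MeasurableSet.univ_pi hs)]
  have hpre : (fun u : α × (ι → α) => Function.update u.2 j u.1) ⁻¹' Set.univ.pi s =
      s j ×ˢ Set.univ.pi (Function.update s j Set.univ) := by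
    ext u
    simp only [Set.mem_preimage, Set.mem_pi, Set.mem_univ, true_imp_iff, Set.mem_prod]
    constructor
    · intro h
      refine ⟨by simpa using h j, fun i => ?_⟩
      rcases eq_or_ne i j with rfl | hi
      · simp
      · simpa [hi] using h i
    · rintro ⟨h1, h2⟩ i
      rcases eq_or_ne i j with rfl | hi
      · simpa using h1
      · simpa [hi] using h2 i
  rw [hpre, Measure.prod_prod, Measure.pi_pi, ← Finset.mul_prod_erase _ _ (Finset.mem_univ j),
    ← Finset.mul_prod_erase _ (fun i => μ (s i)) (Finset.mem_univ j)]
  simp only [Function.update_self, measure_univ, one_mul]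
  congr 1
  refine Finset.prod_congr rfl fun i hi => ?_
  rw [Function.update_of_ne (Finset.ne_of_mem_erase hi)]

variable {μ}

theorem pi_eq_lintegral_piecewise (F : Finset ι) {A : Set (ι → α)} (hA : MeasurableSet A) :
    Measure.pi (fun _ => μ) A =
      ∫⁻ x, Measure.pi (fun _ => μ) {y | F.piecewise x y ∈ A} ∂Measure.pi fun _ => μ := by
  rw [← (measurePreserving_finset_piecewise μ F).measure_preimage hA.nullMeasurableSet,
    Measure.prod_apply ((measurePreserving_finset_piecewise μ F).measurable hA)]
  rfl

theorem pi_eq_lintegral_update (j : ι) {A : Set (ι → α)} (hA : MeasurableSet A) :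
    Measure.pi (fun _ => μ) A =
      ∫⁻ z, Measure.pi (fun _ => μ) {y | Function.update y j z ∈ A} ∂μ := by
  rw [← (measurePreserving_update μ j).measure_preimage hA.nullMeasurableSet,
    Measure.prod_apply ((measurePreserving_update μ j).measurable hA)]
  rfl

theorem pi_eq_lintegral_update_swap (j : ι) {A : Set (ι → α)} (hA : MeasurableSet A) :
    Measure.pi (fun _ => μ) A =
      ∫⁻ y, μ {z | Function.update y j z ∈ A} ∂Measure.pi fun _ => μ := by
  rw [← (measurePreserving_update μ j).measure_preimage hA.nullMeasurableSet,
    Measure.prod_apply_symm ((measurePreserving_update μ j).measurable hA)]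
  rfl

/-- If membership in `A` forces the `j`-th coordinate `z` into `B` and all coordinates outside
`insert j F` out of `S z`, then the probability of `A` is at most the integral over `B` of
`(1 - μ (S z)) ^ (|ι| - |F| - 1)`. -/
theorem pi_le_setLIntegral_pow {F : Finset ι} {j : ι} (hj : j ∉ F) {A : Set (ι → α)}
    (hA : MeasurableSet A) {B : Set α} (hB : MeasurableSet B) {S : α → Set α}
    (hS : ∀ z, MeasurableSet (S z))
    (hAB : ∀ y ∈ A, y j ∈ B ∧ ∀ l ∉ insert j F, y l ∉ S (y j)) :
    Measure.pi (fun _ => μ) A ≤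
      ∫⁻ z in B, (1 - μ (S z)) ^ (Fintype.card ι - F.card - 1) ∂μ := by
  rw [pi_eq_lintegral_update j hA, ← lintegral_indicator hB]
  refine lintegral_mono fun z => ?_
  by_cases hz : z ∈ B
  · rw [Set.indicator_of_mem hz]
    have hsub : {y | Function.update y j z ∈ A} ⊆
        Set.univ.pi fun l => if l ∈ insert j F then Set.univ else (S z)ᶜ := by
      intro y hy l _
      have h := (hAB _ hy).2 l
      by_cases hl : l ∈ insert j F
      · simp only [hl, if_true, Set.mem_univ]
      · have hlj : l ≠ j := fun h => hl (h ▸ Finset.mem_insert_self _ _)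
        simpa [hl, hlj] using h hl
    refine (measure_mono hsub).trans (le_of_eq ?_)
    rw [Measure.pi_pi]
    have : ∀ l, μ (if l ∈ insert j F then Set.univ else (S z)ᶜ) =
        if l ∈ insert j F then 1 else 1 - μ (S z) := by
      intro l
      split_ifs
      · exact measure_univ
      · exact prob_compl_eq_one_sub (hS z)
    simp only [this]
    rw [Finset.prod_ite, Finset.prod_const_one, one_mul, Finset.prod_const]
    congr 1
    have : (Finset.univ.filter fun l => l ∉ insert j F) = (insert j F)ᶜ := by ext; simp
    rw [this, Finset.card_compl, Finset.card_insert_of_notMem hj]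
    omega
  · rw [Set.indicator_of_notMem hz]
    have : {y | Function.update y j z ∈ A} = ∅ := by
      ext y
      simp only [Set.mem_ofPred_eq, Set.mem_empty_iff_false, iff_false]
      intro hy
      exact hz (by simpa using (hAB _ hy).1)
    rw [this]
    simp

end ProductMeasure

section GeneralPosition

variable {d : ℕ}

theorem coord_add (y z : EuclideanSpace ℝ (Fin d)) (j : ℕ) :
    coord (y + z) j = coord y j + coord z j := by
  unfold coord
  split_ifs <;> simp

theorem coord_smul (c : ℝ) (z : EuclideanSpace ℝ (Fin d)) (j : ℕ) :
    coord (c • z) j = c * coord z j := by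
  unfold coord
  split_ifs <;> simp

theorem volume_leadDet_update_eq_zero {k : ℕ} (hk : k < d) (p : ℕ → EuclideanSpace ℝ (Fin d))
    (hp : leadDet p k ≠ 0) :
    volume {z : EuclideanSpace ℝ (Fin d) |
      leadDet (Function.update p (k + 1) z) (k + 1) = 0} = 0 := by
  obtain ⟨c, hc, hz⟩ := leadDet_update_succ p k
  let W : Submodule ℝ (EuclideanSpace ℝ (Fin d)) :=
    { carrier := {z | ∑ j ∈ Finset.range (k + 1), c j * coord z j = 0}
      add_mem' := by
        intro y z hy hz
        simp only [Set.mem_ofPred_eq] at *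
        simp only [coord_add, mul_add, Finset.sum_add_distrib, hy, hz, add_zero]
      zero_mem' := by simp [coord]
      smul_mem' := by
        intro a z hz
        simp only [Set.mem_ofPred_eq] at *
        simp only [coord_smul, mul_left_comm _ a, ← Finset.mul_sum, hz, mul_zero] }
  have hW : W ≠ ⊤ := by
    intro h
    have hmem : EuclideanSpace.single (⟨k, hk⟩ : Fin d) (1 : ℝ) ∈ W := h ▸ Submodule.mem_top
    have h0 : ∑ j ∈ Finset.range (k + 1),
        c j * coord (EuclideanSpace.single (⟨k, hk⟩ : Fin d) (1 : ℝ)) j = 0 := hmem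
    rw [Finset.sum_range_succ, Finset.sum_eq_zero] at h0
    · simp [coord, hk] at h0
      exact hp (hc ▸ h0)
    · intro j hj
      have := Finset.mem_range.1 hj
      simp [coord, this.ne, this.trans hk]
  have hpre : {z : EuclideanSpace ℝ (Fin d) |
      leadDet (Function.update p (k + 1) z) (k + 1) = 0} =
      (fun z => z + -p 0) ⁻¹' (W : Set (EuclideanSpace ℝ (Fin d))) := by
    ext z
    have hneg : ∀ j, coord (-p 0) j = - coord (p 0) j := fun j => by
      rw [← neg_one_smul ℝ, coord_smul]; ring
    change _ ↔ ∑ j ∈ Finset.range (k + 1), c j * coord (z + -p 0) j = 0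
    simp only [Set.mem_ofPred_eq, hz, coord_add, hneg, sub_eq_add_neg]
  rw [hpre, measure_preimage_add_right]
  exact Measure.addHaar_submodule volume W hW

theorem ae_leadDet_ne_zero {ι : Type*} [Fintype ι] {μ : Measure (EuclideanSpace ℝ (Fin d))}
    [IsProbabilityMeasure μ] (hμ : μ ≪ volume) {s : ℕ → ι} (hs : Set.InjOn s (Set.Iio d))
    {k : ℕ} (hk : k < d) :
    ∀ᵐ x ∂(Measure.pi fun _ : ι => μ), leadDet (fun i => x (s i)) k ≠ 0 := by
  classical
  induction k with
  | zero => simp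
  | succ k ih =>
    have hcont : ∀ m, Continuous fun x : ι → EuclideanSpace ℝ (Fin d) =>
        leadDet (fun i => x (s i)) m := fun m =>
      (continuous_leadDet m).comp
        (continuous_pi (f := fun (x : ι → EuclideanSpace ℝ (Fin d)) i => x (s i)) fun i => continuous_apply (s i))
    let N : Set (ι → EuclideanSpace ℝ (Fin d)) :=
      {x | leadDet (fun i => x (s i)) (k + 1) = 0 ∧ leadDet (fun i => x (s i)) k ≠ 0}
    have hN : MeasurableSet N :=
      ((hcont (k + 1)).measurable (measurableSet_singleton 0)).inter
        ((hcont k).measurable (measurableSet_singleton 0).compl)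
    have hN0 : Measure.pi (fun _ : ι => μ) N = 0 := by
      rw [pi_eq_lintegral_update_swap (s (k + 1)) hN, lintegral_eq_zero_of_ae_eq_zero]
      refine Filter.Eventually.of_forall fun x => hμ ?_
      have hne : ∀ i ≤ k, s i ≠ s (k + 1) := fun i hi h => by
        have := hs (Set.mem_Iio.2 (by omega : i < d)) (Set.mem_Iio.2 hk) h
        omega
      have h1 : ∀ z, leadDet (fun i => Function.update x (s (k + 1)) z (s i)) k =
          leadDet (fun i => x (s i)) k := fun z =>
        leadDet_congr fun i hi => by simp [hne i hi]
      have h2 : ∀ z, leadDet (fun i => Function.update x (s (k + 1)) z (s i)) (k + 1) =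
          leadDet (Function.update (fun i => x (s i)) (k + 1) z) (k + 1) := fun z =>
        leadDet_congr fun i hi => by
          rcases Nat.lt_or_ge k i with h | h
          · obtain rfl : i = k + 1 := by omega
            simp
          · have hik : i ≠ k + 1 := by omega
            rw [Function.update_of_ne (hne i h), Function.update_of_ne hik]
      by_cases h0 : leadDet (fun i => x (s i)) k = 0
      · simp [N, h1, h0]
      · simp only [N, Set.mem_ofPred_eq, h1, h2, h0, ne_eq, not_false_eq_true, and_true]
        exact volume_leadDet_update_eq_zero (by omega) _ h0
    filter_upwards [ih (by omega), measure_eq_zero_iff_ae_notMem.1 hN0] with x hx1 hx2 h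
    exact hx2 ⟨h, hx1⟩

end GeneralPosition

section LayerCake

theorem lintegral_one_sub_pow_le {α : Type*} [MeasurableSpace α] {ν : Measure α} {g : α → ℝ}
    (hg : Measurable g) {C : ℝ} (hC : 0 ≤ C) (hg0 : ∀ x, 0 ≤ g x)
    (hν : ∀ t, 0 ≤ t → ν {x | g x ≤ t} ≤ ENNReal.ofReal (C * t))
    (hg1 : ∀ᵐ x ∂ν, g x ≤ 1) (m : ℕ) :
    ∫⁻ x, ENNReal.ofReal ((1 - g x) ^ m) ∂ν ≤ ENNReal.ofReal (C / (m + 1)) := by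
  rcases m with _ | k
  · have : ν Set.univ = ν {x | g x ≤ 1} :=
      measure_congr (by filter_upwards [hg1] with x hx; exact (eq_true hx).symm)
    simpa [this] using hν 1 zero_le_one
  have hpow : ∀ u : ℝ, ∫ t in (0 : ℝ)..u, ((k : ℝ) + 1) * t ^ k = u ^ (k + 1) := by
    intro u
    rw [intervalIntegral.integral_const_mul, integral_pow]
    have : (k : ℝ) + 1 ≠ 0 := by positivity
    field_simp
    simp
  have hlc := lintegral_comp_eq_lintegral_meas_le_mul ν (f := fun x => 1 - g x)
    (g := fun t => ((k : ℝ) + 1) * t ^ k)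
    (by filter_upwards [hg1] with x hx; simpa using hx) (by fun_prop)
    (fun t _ => by apply Continuous.intervalIntegrable; fun_prop)
    (by
      filter_upwards [ae_restrict_mem measurableSet_Ioi] with t ht
      have : (0 : ℝ) < t := ht
      positivity)
  simp only [hpow] at hlc
  rw [hlc]
  have hbound : ∫⁻ t in Set.Ioi (0 : ℝ), ν {a | t ≤ 1 - g a} *
      ENNReal.ofReal (((k : ℝ) + 1) * t ^ k) ≤
      ∫⁻ t in Set.Ioc (0 : ℝ) 1, ENNReal.ofReal (C * (1 - t) * (((k : ℝ) + 1) * t ^ k)) := by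
    rw [← lintegral_indicator measurableSet_Ioi, ← lintegral_indicator measurableSet_Ioc]
    refine lintegral_mono fun t => ?_
    by_cases ht : 0 < t
    · rw [Set.indicator_of_mem (Set.mem_Ioi.2 ht)]
      have hset : {a | t ≤ 1 - g a} = {a | g a ≤ 1 - t} := by
        ext a
        simp only [Set.mem_ofPred_eq]
        constructor <;> intro h <;> linarith
      rw [hset]
      rcases le_or_gt t 1 with h1 | h1
      · rw [Set.indicator_of_mem (Set.mem_Ioc.2 ⟨ht, h1⟩),
          ENNReal.ofReal_mul (mul_nonneg hC (by linarith))]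
        gcongr
        exact hν _ (by linarith)
      · have : {a | g a ≤ 1 - t} = ∅ := by
          ext a
          simp only [Set.mem_ofPred_eq, Set.mem_empty_iff_false, iff_false]
          linarith [hg0 a]
        rw [this]
        simp
    · rw [Set.indicator_of_notMem (by simpa using ht)]
      exact zero_le
  refine hbound.trans ?_
  rw [← ofReal_integral_eq_lintegral_ofReal]
  · refine ENNReal.ofReal_le_ofReal (le_of_eq ?_)
    rw [← intervalIntegral.integral_of_le zero_le_one]
    have : ∀ t : ℝ, C * (1 - t) * (((k : ℝ) + 1) * t ^ k) =
        C * (k + 1) * (t ^ k - t ^ (k + 1)) := fun t => by ring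
    simp only [this]
    rw [intervalIntegral.integral_const_mul, intervalIntegral.integral_sub
      (by apply Continuous.intervalIntegrable; fun_prop)
      (by apply Continuous.intervalIntegrable; fun_prop), integral_pow, integral_pow]
    push_cast
    have h1 : (k : ℝ) + 1 ≠ 0 := by positivity
    have h2 : (k : ℝ) + 1 + 1 ≠ 0 := by positivity
    simp
    field_simp
    ring
  · exact (Continuous.integrableOn_Icc (by fun_prop)).mono_set Set.Ioc_subset_Icc_self
  · filter_upwards [ae_restrict_mem measurableSet_Ioc] with t ht
    have h1 : 0 ≤ 1 - t := by linarith [ht.2]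
    have h2 : 0 < t := ht.1
    simp only [Pi.zero_apply]
    positivity

variable {d : ℕ}

theorem isClosed_greedy_region (p : ℕ → EuclideanSpace ℝ (Fin d)) :
    IsClosed {z | ∀ k < d, greedyVal p k z ≤ greedyVal p k (p k)} := by
  simp only [Set.ofPred_forall]
  exact isClosed_iInter fun k => isClosed_iInter fun _ => isClosed_le
    ((continuous_greedyVal k).comp (by fun_prop : Continuous fun z => (p, z))) continuous_const

theorem setLIntegral_greedy_region_le (hd : 0 < d) {K : Set (EuclideanSpace ℝ (Fin d))}
    (hK : Convex ℝ K) (hKm : MeasurableSet K) (hvol : volume K = 1)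
    (p : ℕ → EuclideanSpace ℝ (Fin d)) (hpK : ∀ k < d, p k ∈ K)
    (hp : ∀ k < d, leadDet p k ≠ 0) (m : ℕ) :
    ∫⁻ z in {z | ∀ k < d, greedyVal p k z ≤ greedyVal p k (p k)},
      (1 - volume.restrict K (interior (convexHull ℝ (Function.update p d z '' Set.Iic d)))) ^ m
        ∂volume.restrict K ≤ ENNReal.ofReal (2 ^ (d - 1) * d.factorial / (m + 1)) := by
  set B := {z | ∀ k < d, greedyVal p k z ≤ greedyVal p k (p k)} with hB
  have hBm : MeasurableSet B := (isClosed_greedy_region p).measurableSet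
  have hf : (0 : ℝ) < d.factorial := by positivity
  let g : EuclideanSpace ℝ (Fin d) → ℝ := fun z =>
    |leadDet (Function.update p d z) d| / d.factorial
  have hg : Measurable g := by
    have : Continuous fun z => leadDet (Function.update p d z) d :=
      (continuous_leadDet d).comp (continuous_const.update d continuous_id)
    exact (this.abs.div_const _).measurable
  have hKae : ∀ᵐ z ∂(volume.restrict K).restrict B, z ∈ K :=
    ae_restrict_of_ae (ae_restrict_mem hKm)
  have hsub : ∀ z ∈ K,
      interior (convexHull ℝ (Function.update p d z '' Set.Iic d)) ⊆ K := by
    intro z hz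
    refine interior_subset.trans (convexHull_min ?_ hK)
    rintro _ ⟨i, hi, rfl⟩
    rcases eq_or_ne i d with rfl | h
    · simpa using hz
    · simpa [h] using hpK i (lt_of_le_of_ne hi h)
  have hg1 : ∀ z ∈ K, g z ≤ 1 := by
    intro z hz
    have h1 := (ofReal_abs_leadDet_le (Function.update p d z)).trans
      (measure_mono (μ := volume) (hsub z hz))
    rw [hvol] at h1
    simpa [g] using h1
  have hmain : ∀ z ∈ K,
      (1 - volume.restrict K (interior (convexHull ℝ (Function.update p d z '' Set.Iic d)))) ^ m ≤
        ENNReal.ofReal ((1 - g z) ^ m) := by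
    intro z hz
    rw [Measure.restrict_eq_self _ (hsub z hz),
      ENNReal.ofReal_pow (by linarith [hg1 z hz]), ENNReal.ofReal_sub _ (by positivity),
      ENNReal.ofReal_one]
    gcongr
    exact ofReal_abs_leadDet_le _
  refine (lintegral_mono_ae (hKae.mono hmain)).trans ?_
  refine lintegral_one_sub_pow_le hg (by positivity) (fun z => by positivity) ?_
    (hKae.mono hg1) m
  intro t ht
  rw [Measure.restrict_apply (measurableSet_le hg measurable_const)]
  refine (Measure.restrict_le_self _).trans ?_
  have h := volume_greedy_region_le hd p hp (r := t * d.factorial) (by positivity)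
  rw [mul_comm t, ← mul_assoc] at h
  refine (measure_mono ?_).trans h
  rintro z ⟨h1, h2⟩
  refine ⟨h2, ?_⟩
  have h1' : |leadDet (Function.update p d z) d| / d.factorial ≤ t := h1
  rw [div_le_iff₀ hf] at h1'
  linarith

end LayerCake

/-- The key by which a greedy ordering selects its `k`-th index; ties are broken by the index. -/
noncomputable def greedyKey {d n : ℕ} (x : Fin n → EuclideanSpace ℝ (Fin d)) (s : ℕ → Fin n)
    (k : ℕ) (i : Fin n) : ℝ ×ₗ Fin n :=
  toLex (greedyVal (fun a => x (s a)) k (x i), i)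

/-- For every `k < d`, the index `s k` maximises the key among `s k, …, s (d - 1)`. -/
def IsGreedy {d n : ℕ} (x : Fin n → EuclideanSpace ℝ (Fin d)) (s : ℕ → Fin n) : Prop :=
  ∀ k < d, ∀ l < d, k < l → greedyKey x s k (s l) ≤ greedyKey x s k (s k)

/-- The extension of a finite sequence to a periodic sequence indexed by `ℕ`. -/
def periodicExtend {d : ℕ} [NeZero d] {ι : Type*} (s : Fin d → ι) (k : ℕ) : ι :=
  s (Fin.ofNat d k)

section Greedy

variable {d n : ℕ}

theorem periodicExtend_apply [NeZero d] {ι : Type*} (s : Fin d → ι) (k : Fin d) :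
    periodicExtend s k = s k := by
  simp [periodicExtend]

theorem periodicExtend_mem [NeZero d] {ι : Type*} (e : Fin d ↪ ι) (k : ℕ) :
    periodicExtend e k ∈ Finset.univ.map e :=
  Finset.mem_map_of_mem e (Finset.mem_univ _)

theorem periodicExtend_injOn [NeZero d] {ι : Type*} (e : Fin d ↪ ι) :
    Set.InjOn (periodicExtend e) (Set.Iio d) := by
  intro a ha b hb h
  have h1 := periodicExtend_apply e ⟨a, ha⟩
  have h2 := periodicExtend_apply e ⟨b, hb⟩
  simp only at h1 h2
  rw [h1, h2] at h
  exact congrArg Fin.val (e.injective h)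

theorem greedyKey_congr (x : Fin n → EuclideanSpace ℝ (Fin d)) {s t : ℕ → Fin n} {k : ℕ}
    (h : ∀ a < k, s a = t a) (i : Fin n) : greedyKey x s k i = greedyKey x t k i := by
  unfold greedyKey
  rw [greedyVal_congr fun a ha => by rw [h a ha]]

theorem greedyKey_injective (x : Fin n → EuclideanSpace ℝ (Fin d)) (s : ℕ → Fin n) (k : ℕ) :
    Function.Injective (greedyKey x s k) := by
  intro i j h
  exact congrArg Prod.snd (toLex.injective h)

theorem greedyVal_le_of_greedyKey_le {x : Fin n → EuclideanSpace ℝ (Fin d)} {s : ℕ → Fin n}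
    {k : ℕ} {i j : Fin n} (h : greedyKey x s k i ≤ greedyKey x s k j) :
    greedyVal (fun a => x (s a)) k (x i) ≤ greedyVal (fun a => x (s a)) k (x j) := by
  rcases Prod.Lex.toLex_le_toLex.1 h with h | h
  · exact h.le
  · exact h.1.le

theorem exists_greedy_sequence (x : Fin n → EuclideanSpace ℝ (Fin d)) {T : Finset (Fin n)}
    (hT : T.Nonempty) {m : ℕ} (hm : m ≤ T.card) :
    ∃ s : ℕ → Fin n, Set.InjOn s (Set.Iio m) ∧ (∀ k < m, s k ∈ T) ∧
      ∀ k < m, ∀ i ∈ T, (∀ a < k, i ≠ s a) → greedyKey x s k i ≤ greedyKey x s k (s k) := by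
  induction m with
  | zero => exact ⟨fun _ => hT.choose, by simp, by simp, by simp⟩
  | succ m ih =>
    obtain ⟨s, hs1, hs2, hs3⟩ := ih (by omega)
    have hne : (T \ (Finset.range m).image s).Nonempty := by
      refine Finset.sdiff_nonempty.2 fun h => ?_
      have := (Finset.card_le_card h).trans Finset.card_image_le
      rw [Finset.card_range] at this
      omega
    obtain ⟨j, hj, hmax⟩ := Finset.exists_max_image _ (greedyKey x s m) hne
    obtain ⟨hjT, hj'⟩ := Finset.mem_sdiff.1 hj
    have hjs : ∀ a < m, j ≠ s a := fun a ha h =>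
      hj' (Finset.mem_image.2 ⟨a, Finset.mem_range.2 ha, h.symm⟩)
    have hlt : ∀ a < m, Function.update s m j a = s a := fun a ha => by simp [ha.ne]
    refine ⟨Function.update s m j, ?_, ?_, ?_⟩
    · intro a ha b hb h
      have ha' : a < m + 1 := ha
      have hb' : b < m + 1 := hb
      rcases Nat.lt_succ_iff_lt_or_eq.1 ha' with ha | rfl <;>
        rcases Nat.lt_succ_iff_lt_or_eq.1 hb' with hb | rfl
      · rw [hlt a ha, hlt b hb] at h
        exact hs1 ha hb h
      · rw [hlt a ha, Function.update_self] at h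
        exact absurd h.symm (hjs a ha)
      · rw [hlt b hb, Function.update_self] at h
        exact absurd h (hjs b hb)
      · rfl
    · intro k hk
      rcases Nat.lt_succ_iff_lt_or_eq.1 hk with hk | rfl
      · rw [hlt k hk]
        exact hs2 k hk
      · simpa using hjT
    · intro k hk i hi hia
      have hkm : k ≤ m := Nat.lt_succ_iff.1 hk
      rw [greedyKey_congr x fun a ha => hlt a (ha.trans_le hkm),
        greedyKey_congr x fun a ha => hlt a (ha.trans_le hkm)]
      have hia' : ∀ a < k, i ≠ s a := fun a ha => hlt a (ha.trans_le hkm) ▸ hia a ha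
      rcases Nat.lt_succ_iff_lt_or_eq.1 hk with hk | rfl
      · rw [hlt k hk]
        exact hs3 k hk i hi hia'
      · rw [Function.update_self]
        refine hmax i (Finset.mem_sdiff.2 ⟨hi, fun h => ?_⟩)
        obtain ⟨a, ha, rfl⟩ := Finset.mem_image.1 h
        exact hia' a (Finset.mem_range.1 ha) rfl

theorem IsGreedy.eq_of_image_eq {x : Fin n → EuclideanSpace ℝ (Fin d)} {s t : ℕ → Fin n}
    (hs : IsGreedy x s) (ht : IsGreedy x t) (hsi : Set.InjOn s (Set.Iio d))
    (hti : Set.InjOn t (Set.Iio d)) (h : s '' Set.Iio d = t '' Set.Iio d) :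
    ∀ k < d, s k = t k := by
  intro k
  induction k using Nat.strong_induction_on with
  | _ k ih =>
    intro hk
    have hle : ∀ {s t : ℕ → Fin n}, IsGreedy x t → Set.InjOn s (Set.Iio d) →
        s '' Set.Iio d = t '' Set.Iio d → (∀ a < k, s a = t a) →
        greedyKey x t k (s k) ≤ greedyKey x t k (t k) := by
      intro s t ht hsi h hst
      obtain ⟨l, hl, hlk⟩ : s k ∈ t '' Set.Iio d := h ▸ Set.mem_image_of_mem s hk
      rcases lt_trichotomy k l with hkl | rfl | hkl
      · rw [← hlk]
        exact ht k hk l hl hkl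
      · rw [hlk]
      · rw [← hst l hkl] at hlk
        exact absurd (hsi hl hk hlk) hkl.ne
    have hst : ∀ a < k, s a = t a := fun a ha => ih a ha (ha.trans hk)
    have h1 := hle ht hsi h hst
    have h2 := hle hs hti h.symm fun a ha => (hst a ha).symm
    rw [greedyKey_congr x hst, greedyKey_congr x hst] at h2
    exact greedyKey_injective x t k (le_antisymm h1 h2)

theorem image_periodicExtend [NeZero d] {ι : Type*} (e : Fin d ↪ ι) :
    periodicExtend e '' Set.Iio d = (Finset.univ.map e : Finset ι) := by
  ext i
  constructor
  · rintro ⟨k, _, rfl⟩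
    exact periodicExtend_mem e k
  · intro hi
    obtain ⟨k, _, rfl⟩ := Finset.mem_map.1 hi
    exact ⟨k, k.2, periodicExtend_apply e k⟩

open Classical in
theorem card_isGreedy_le [NeZero d] (x : Fin n → EuclideanSpace ℝ (Fin d)) :
    (Finset.univ.filter fun e : Fin d ↪ Fin n => IsGreedy x (periodicExtend e)).card ≤
      n.choose d := by
  have : n.choose d = (Finset.powersetCard d (Finset.univ : Finset (Fin n))).card := by simp
  rw [this]
  refine Finset.card_le_card_of_injOn (fun e => Finset.univ.map e) ?_ ?_
  · intro e _
    simp [Finset.mem_powersetCard]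
  · intro e he f hf h
    have he' := (Finset.mem_filter.1 he).2
    have hf' := (Finset.mem_filter.1 hf).2
    have himg : periodicExtend e '' Set.Iio d = periodicExtend f '' Set.Iio d := by
      rw [image_periodicExtend, image_periodicExtend]
      exact congrArg _ h
    ext1 k
    have := he'.eq_of_image_eq hf' (periodicExtend_injOn e) (periodicExtend_injOn f) himg k k.2
    rwa [periodicExtend_apply, periodicExtend_apply] at this

end Greedy

/-- The points with indices in the range of `e` are in greedy order, the point with index `j` could
come next in that order, and the simplex spanned by these points contains no further point. -/
def IsGreedyEmptySimplex {d n : ℕ} [NeZero d] (K : Set (EuclideanSpace ℝ (Fin d)))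
    (e : Fin d ↪ Fin n) (j : Fin n) (x : Fin n → EuclideanSpace ℝ (Fin d)) : Prop :=
  IsGreedy x (periodicExtend e) ∧
    (∀ k < d, x (periodicExtend e k) ∈ K) ∧
    (∀ k < d, leadDet (fun a => x (periodicExtend e a)) k ≠ 0) ∧
    (∀ k < d, greedyVal (fun a => x (periodicExtend e a)) k (x j) ≤
      greedyVal (fun a => x (periodicExtend e a)) k (x (periodicExtend e k))) ∧
    ∀ l ∉ insert j (Finset.univ.map e), x l ∉ interior (convexHull ℝ
      (x '' (insert j (Finset.univ.map e) : Finset (Fin n))))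

section Probability

variable {d n : ℕ}

theorem measurable_greedyVal (s : ℕ → Fin n) (k : ℕ) (i : Fin n) :
    Measurable fun x : Fin n → EuclideanSpace ℝ (Fin d) =>
      greedyVal (fun a => x (s a)) k (x i) :=
  ((continuous_greedyVal k).comp ((continuous_pi
    (f := fun (x : Fin n → EuclideanSpace ℝ (Fin d)) a => x (s a))
    fun a => continuous_apply (s a)).prodMk (continuous_apply i))).measurable

theorem measurableSet_forall_imp {α ι : Type*} [MeasurableSpace α] [Countable ι] {q : ι → Prop}
    {r : ι → α → Prop} (h : ∀ i, MeasurableSet {x | r i x}) :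
    MeasurableSet {x | ∀ i, q i → r i x} := by
  simp only [Set.ofPred_forall]
  exact MeasurableSet.iInter fun i => MeasurableSet.iInter fun _ => h i

theorem measurableSet_isGreedy (s : ℕ → Fin n) :
    MeasurableSet {x : Fin n → EuclideanSpace ℝ (Fin d) | IsGreedy x s} := by
  simp only [IsGreedy, greedyKey, Prod.Lex.toLex_le_toLex]
  refine measurableSet_forall_imp fun k => measurableSet_forall_imp fun l => ?_
  simp only [Set.ofPred_forall]
  refine MeasurableSet.iInter fun _ => MeasurableSet.union ?_ (MeasurableSet.inter ?_ ?_)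
  · exact measurableSet_lt (measurable_greedyVal s k _) (measurable_greedyVal s k _)
  · exact measurableSet_eq_fun (measurable_greedyVal s k _) (measurable_greedyVal s k _)
  · exact MeasurableSet.const _

theorem measurableSet_isGreedyEmptySimplex [NeZero d] {K : Set (EuclideanSpace ℝ (Fin d))}
    (hK : MeasurableSet K) (e : Fin d ↪ Fin n) (j : Fin n) :
    MeasurableSet {x | IsGreedyEmptySimplex K e j x} := by
  refine (measurableSet_isGreedy _).inter (MeasurableSet.inter ?_ (MeasurableSet.inter ?_
    (MeasurableSet.inter ?_ ?_))) <;> refine measurableSet_forall_imp fun k => ?_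
  · exact measurable_pi_apply (periodicExtend e k) hK
  · have hc : Continuous fun x : Fin n → EuclideanSpace ℝ (Fin d) =>
        leadDet (fun a => x (periodicExtend e a)) k :=
      (continuous_leadDet k).comp (continuous_pi
        (f := fun (x : Fin n → EuclideanSpace ℝ (Fin d)) a => x (periodicExtend e a))
        fun a => continuous_apply _)
    exact hc.measurable (measurableSet_singleton 0).compl
  · exact measurableSet_le (measurable_greedyVal _ k _) (measurable_greedyVal _ k _)
  · exact (measurableSet_apply_mem_interior_convexHull_image _ k).compl

theorem image_insert_map_eq [NeZero d] (e : Fin d ↪ Fin n) (j : Fin n)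
    (x : Fin n → EuclideanSpace ℝ (Fin d)) :
    x '' (insert j (Finset.univ.map e) : Finset (Fin n)) =
      Function.update (fun a => x (periodicExtend e a)) d (x j) '' Set.Iic d := by
  have h : Set.Iic d = insert d (Set.Iio d) := (Set.Iio_insert (a := d)).symm
  rw [h, Set.image_insert_eq, Function.update_self, Finset.coe_insert, Set.image_insert_eq,
    ← image_periodicExtend, Set.image_image]
  congr 1
  refine Set.image_congr fun a ha => ?_
  rw [Function.update_of_ne (ne_of_lt ha)]

theorem pi_isGreedyEmptySimplex_le [NeZero d] {K : Set (EuclideanSpace ℝ (Fin d))}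
    (hK : Convex ℝ K) (hKm : MeasurableSet K) (hvol : volume K = 1)
    [IsProbabilityMeasure (volume.restrict K)] (e : Fin d ↪ Fin n) {j : Fin n}
    (hj : j ∉ Finset.univ.map e) :
    (Measure.pi fun _ : Fin n => volume.restrict K) {x | IsGreedyEmptySimplex K e j x} ≤
      ENNReal.ofReal (2 ^ (d - 1) * d.factorial / (n - d : ℕ)) *
        (Measure.pi fun _ : Fin n => volume.restrict K)
          {x : Fin n → EuclideanSpace ℝ (Fin d) | IsGreedy x (periodicExtend e)} := by
  set F : Finset (Fin n) := Finset.univ.map e with hF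
  have hE := measurableSet_isGreedyEmptySimplex hKm e j
  rw [pi_eq_lintegral_piecewise F hE, ← lintegral_indicator_const (measurableSet_isGreedy _)]
  refine lintegral_mono fun x => ?_
  have hs : ∀ k, periodicExtend e k ∈ F := periodicExtend_mem e
  have hw : ∀ y : Fin n → EuclideanSpace ℝ (Fin d),
      (fun a => F.piecewise x y (periodicExtend e a)) = fun a => x (periodicExtend e a) :=
    fun y => funext fun a => Finset.piecewise_eq_of_mem _ _ _ (hs a)
  have hw' : ∀ (y : Fin n → EuclideanSpace ℝ (Fin d)) k,
      F.piecewise x y (periodicExtend e k) = x (periodicExtend e k) :=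
    fun y k => congrFun (hw y) k
  have hFcard : F.card = d := by simp [hF]
  by_cases hx : IsGreedy x (periodicExtend e) ∧ (∀ k < d, x (periodicExtend e k) ∈ K) ∧
      ∀ k < d, leadDet (fun a => x (periodicExtend e a)) k ≠ 0
  · obtain ⟨hx1, hx2, hx3⟩ := hx
    rw [Set.indicator_of_mem (by exact hx1)]
    have hA : MeasurableSet {y | F.piecewise x y ∈ {x | IsGreedyEmptySimplex K e j x}} :=
      ((measurePreserving_finset_piecewise (volume.restrict K) F).measurable.comp
        (measurable_prodMk_left (x := x))) hE
    have hbound := pi_le_setLIntegral_pow (μ := volume.restrict K) hj hA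
      (isClosed_greedy_region (d := d) fun a => x (periodicExtend e a)).measurableSet
      (S := fun z => interior (convexHull ℝ
        (Function.update (fun a => x (periodicExtend e a)) d z '' Set.Iic d)))
      (fun z => isOpen_interior.measurableSet) (by
        rintro y ⟨-, -, -, h4, h5⟩
        have hyj : F.piecewise x y j = y j := Finset.piecewise_eq_of_notMem _ _ _ hj
        refine ⟨fun k hk => ?_, fun l hl => ?_⟩
        · have := h4 k hk
          rwa [hw, hyj, hw'] at this
        · have := h5 l hl
          rw [image_insert_map_eq, hw, hyj] at this
          rwa [Finset.piecewise_eq_of_notMem _ _ _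
            fun h => hl (Finset.mem_insert_of_mem h)] at this)
    refine hbound.trans ?_
    have hdn : d < n := by
      have := Finset.card_lt_univ_of_notMem hj
      rwa [hFcard, Fintype.card_fin] at this
    have hmn : ((n - d - 1 : ℕ) : ℝ) + 1 = (n - d : ℕ) := by
      rw [← Nat.cast_add_one]
      congr 1
      omega
    rw [hFcard, Fintype.card_fin]
    have := setLIntegral_greedy_region_le (NeZero.pos d) hK hKm hvol
      (fun a => x (periodicExtend e a)) hx2 hx3 (n - d - 1)
    rwa [hmn] at this
  · have hempty : {y | F.piecewise x y ∈ {x | IsGreedyEmptySimplex K e j x}} = ∅ := by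
      refine Set.eq_empty_of_forall_notMem fun y hy => hx ?_
      obtain ⟨h1, h2, h3, -⟩ := hy
      refine ⟨fun k hk l hl hkl => ?_, fun k hk => hw' y k ▸ h2 k hk, fun k hk => ?_⟩
      · have := h1 k hk l hl hkl
        unfold greedyKey at this ⊢
        rwa [hw, hw', hw'] at this
      · have := h3 k hk
        rwa [hw] at this
    rw [hempty, measure_empty]
    exact zero_le

open Classical in
theorem numHoles_pointSet_le [NeZero d] {K : Set (EuclideanSpace ℝ (Fin d))}
    {x : Fin n → EuclideanSpace ℝ (Fin d)} (hx : Function.Injective x) (hxK : ∀ i, x i ∈ K)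
    (hdet : ∀ e : Fin d ↪ Fin n, ∀ k < d, leadDet (fun a => x (periodicExtend e a)) k ≠ 0) :
    numHoles (d + 1) (pointSet x) ≤ ∑ e : Fin d ↪ Fin n, ∑ j ∈ (Finset.univ.map e)ᶜ,
      if IsGreedyEmptySimplex K e j x then 1 else 0 := by
  rw [numHoles_pointSet_eq hx]
  have hsum : (∑ e : Fin d ↪ Fin n, ∑ j ∈ (Finset.univ.map e)ᶜ,
      if IsGreedyEmptySimplex K e j x then 1 else 0) =
      (Finset.univ.sigma fun e : Fin d ↪ Fin n => (Finset.univ.map e)ᶜ.filter fun j =>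
        IsGreedyEmptySimplex K e j x).card := by
    rw [Finset.card_sigma]
    simp only [Finset.card_filter]
  rw [hsum]
  refine Finset.card_le_card_of_surjOn (fun u => insert u.2 (Finset.univ.map u.1)) ?_
  intro T hT
  obtain ⟨hTc, -, hTe⟩ := (Finset.mem_filter.1 hT).2
  have hTne : T.Nonempty := Finset.card_pos.1 (by omega)
  obtain ⟨s, hs1, hs2, hs3⟩ := exists_greedy_sequence x hTne (m := d) (by omega)
  let e : Fin d ↪ Fin n := ⟨fun k => s k, fun a b h => Fin.ext (hs1 a.2 b.2 h)⟩
  have hes : ∀ k < d, periodicExtend e k = s k := fun k hk => periodicExtend_apply e ⟨k, hk⟩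
  have heT : Finset.univ.map e ⊆ T := by
    intro i hi
    obtain ⟨k, _, rfl⟩ := Finset.mem_map.1 hi
    exact hs2 k k.2
  have hecard : (Finset.univ.map e).card = d := by simp
  obtain ⟨j, hj, hjT⟩ := (Finset.exists_eq_insert_iff (s := Finset.univ.map e) (t := T)).2
    ⟨heT, by omega⟩
  have hkey : ∀ k < d, ∀ i, greedyKey x (periodicExtend e) k i = greedyKey x s k i :=
    fun k hk i => greedyKey_congr x (fun a ha => hes a (ha.trans hk)) i
  refine ⟨⟨e, j⟩, ?_, hjT⟩
  simp only [Finset.coe_sigma, Finset.coe_univ, Set.mem_sigma_iff, Set.mem_univ, true_and,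
    Finset.mem_coe, Finset.mem_filter, Finset.mem_compl]
  refine ⟨hj, fun k hk l hl hkl => ?_, fun k _ => hxK _, hdet e, fun k hk => ?_, ?_⟩
  · rw [hkey k hk, hkey k hk, hes k hk, hes l hl]
    refine hs3 k hk _ (hs2 l hl) fun a ha h => ?_
    have := hs1 hl (ha.trans hk) h
    omega
  · refine greedyVal_le_of_greedyKey_le ?_
    rw [hkey k hk, hkey k hk, hes k hk]
    refine hs3 k hk _ (hjT ▸ Finset.mem_insert_self _ _) fun a ha h => hj ?_
    rw [h, ← hes a (ha.trans hk)]
    exact periodicExtend_mem e a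
  · intro l _
    rw [hjT]
    exact hTe l

theorem ae_injective {μ : Measure (EuclideanSpace ℝ (Fin d))} [IsProbabilityMeasure μ]
    [NullSingletonClass μ] : ∀ᵐ x ∂(Measure.pi fun _ : Fin n => μ), Function.Injective x := by
  have h : ∀ i j : Fin n, i ≠ j → ∀ᵐ x ∂(Measure.pi fun _ : Fin n => μ), x i ≠ x j := by
    intro i j hij
    have hm : MeasurableSet {x : Fin n → EuclideanSpace ℝ (Fin d) | x i = x j} :=
      measurableSet_eq_fun (measurable_pi_apply i) (measurable_pi_apply j)
    suffices h0 : (Measure.pi fun _ : Fin n => μ) {x | x i = x j} = 0 from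
      measure_eq_zero_iff_ae_notMem.1 h0
    rw [pi_eq_lintegral_update_swap i hm, lintegral_eq_zero_of_ae_eq_zero]
    exact Filter.Eventually.of_forall fun y => by simp [hij.symm]
  have h' : ∀ᵐ x ∂(Measure.pi fun _ : Fin n => μ), ∀ i j : Fin n, i ≠ j → x i ≠ x j := by
    simpa only [ae_all_iff] using h
  filter_upwards [h'] with x hx i j hij
  by_contra hne
  exact hx i j hne hij

theorem lintegral_numHoles_le (hd : 0 < d) {K : Set (EuclideanSpace ℝ (Fin d))}
    (hK : Convex ℝ K) (hKm : MeasurableSet K) (hvol : volume K = 1)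
    [IsProbabilityMeasure (volume.restrict K)] [NullSingletonClass (volume.restrict K)] :
    ∫⁻ x, (numHoles (d + 1) (pointSet x) : ENNReal)
        ∂(Measure.pi fun _ : Fin n => volume.restrict K) ≤
      ENNReal.ofReal (2 ^ (d - 1) * d.factorial * n.choose d) := by
  classical
  have : NeZero d := ⟨hd.ne'⟩
  set π : Measure (Fin n → EuclideanSpace ℝ (Fin d)) :=
    Measure.pi fun _ : Fin n => volume.restrict K with hπ
  let E : (Fin d ↪ Fin n) → Fin n → Set (Fin n → EuclideanSpace ℝ (Fin d)) :=
    fun e j => {x | IsGreedyEmptySimplex K e j x}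
  let G : (Fin d ↪ Fin n) → Set (Fin n → EuclideanSpace ℝ (Fin d)) :=
    fun e => {x | IsGreedy x (periodicExtend e)}
  have hE : ∀ e j, MeasurableSet (E e j) := measurableSet_isGreedyEmptySimplex hKm
  have hG : ∀ e, MeasurableSet (G e) := fun e => measurableSet_isGreedy _
  have hdet : ∀ᵐ x ∂π, ∀ e : Fin d ↪ Fin n, ∀ k < d,
      leadDet (fun a => x (periodicExtend e a)) k ≠ 0 := by
    simp only [ae_all_iff]
    exact fun e k hk =>
      ae_leadDet_ne_zero Measure.absolutelyContinuous_restrict (periodicExtend_injOn e) hk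
  have hKae : ∀ᵐ x ∂π, ∀ i, x i ∈ K := by
    refine ae_all_iff.2 fun i => ?_
    exact (measurePreserving_eval (fun _ : Fin n => volume.restrict K) i).quasiMeasurePreserving.ae
      (ae_restrict_mem hKm)
  have hEG : ∀ e, ∑ j ∈ (Finset.univ.map e)ᶜ, π (E e j) ≤
      ENNReal.ofReal (2 ^ (d - 1) * d.factorial) * π (G e) := by
    intro e
    refine (Finset.sum_le_sum fun j hj => pi_isGreedyEmptySimplex_le hK hKm hvol e
      (Finset.mem_compl.1 hj)).trans ?_
    rw [Finset.sum_const, Finset.card_compl, Finset.card_map, Fintype.card_fin, Finset.card_univ,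
      Fintype.card_fin, nsmul_eq_mul, ← mul_assoc]
    gcongr
    rw [← ENNReal.ofReal_natCast, ← ENNReal.ofReal_mul (by positivity)]
    refine ENNReal.ofReal_le_ofReal ?_
    rcases Nat.eq_zero_or_pos (n - d) with h | h
    · rw [h]
      simp
    · have : (0 : ℝ) < (n - d : ℕ) := by exact_mod_cast h
      rw [mul_div_cancel₀ _ this.ne']
  calc ∫⁻ x, (numHoles (d + 1) (pointSet x) : ENNReal) ∂π
      ≤ ∫⁻ x, ∑ e, ∑ j ∈ (Finset.univ.map e)ᶜ, (E e j).indicator 1 x ∂π := by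
        refine lintegral_mono_ae ?_
        filter_upwards [ae_injective (μ := volume.restrict K), hdet, hKae] with x h1 h2 h3
        have := numHoles_pointSet_le h1 h3 h2
        have h : ((numHoles (d + 1) (pointSet x) : ℕ) : ENNReal) ≤ ((∑ e : Fin d ↪ Fin n,
          ∑ j ∈ (Finset.univ.map e)ᶜ, if IsGreedyEmptySimplex K e j x then 1 else 0 : ℕ) :
            ENNReal) := by exact_mod_cast this
        refine h.trans (le_of_eq ?_)
        simp only [Nat.cast_sum, Nat.cast_ite, Nat.cast_one, Nat.cast_zero, Set.indicator_apply, E,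
          Set.mem_ofPred_eq, Pi.one_apply]
    _ = ∑ e, ∑ j ∈ (Finset.univ.map e)ᶜ, π (E e j) := by
        have hm : ∀ e j, Measurable ((E e j).indicator (1 : (Fin n → EuclideanSpace ℝ (Fin d)) → ENNReal)) := fun e j =>
          measurable_one.indicator (hE e j)
        rw [lintegral_finsetSum _ fun e _ => Finset.measurable_sum _ fun j _ => hm e j]
        refine Finset.sum_congr rfl fun e _ => ?_
        rw [lintegral_finsetSum _ fun j _ => hm e j]
        exact Finset.sum_congr rfl fun j _ => lintegral_indicator_one (hE e j)
    _ ≤ ∑ e, ENNReal.ofReal (2 ^ (d - 1) * d.factorial) * π (G e) :=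
        Finset.sum_le_sum fun e _ => hEG e
    _ = ENNReal.ofReal (2 ^ (d - 1) * d.factorial) * ∫⁻ x, ∑ e, (G e).indicator 1 x ∂π := by
        rw [← Finset.mul_sum,
          lintegral_finsetSum _ fun e _ => measurable_one.indicator (hG e)]
        congr 1
        exact Finset.sum_congr rfl fun e _ => (lintegral_indicator_one (hG e)).symm
    _ ≤ ENNReal.ofReal (2 ^ (d - 1) * d.factorial) * ∫⁻ _, (n.choose d : ENNReal) ∂π := by
        gcongr with x
        have := card_isGreedy_le x
        rw [Finset.card_filter] at this
        have h : ((∑ e : Fin d ↪ Fin n, if IsGreedy x (periodicExtend e) then 1 else 0 : ℕ) :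
          ENNReal) ≤ (n.choose d : ENNReal) := by exact_mod_cast this
        refine le_trans (le_of_eq ?_) h
        simp only [Nat.cast_sum, Nat.cast_ite, Nat.cast_one, Nat.cast_zero, Set.indicator_apply, G,
          Set.mem_ofPred_eq, Pi.one_apply]
    _ = ENNReal.ofReal (2 ^ (d - 1) * d.factorial * n.choose d) := by
        rw [lintegral_const, measure_univ, mul_one,
          ENNReal.ofReal_mul (p := 2 ^ (d - 1) * d.factorial) (by positivity),
          ENNReal.ofReal_natCast]

end Probability

theorem corollary3 (d : ℕ) (hd : 2 ≤ d) (K : Set (EuclideanSpace ℝ (Fin d)))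
    (hK : IsConvexBody K) (hvol : volume K = 1) (n : ℕ)
    {Ω : Type*} [MeasurableSpace Ω] (P : Measure Ω) [IsProbabilityMeasure P]
    (X : Fin n → Ω → EuclideanSpace ℝ (Fin d))
    (hunif : ∀ i, pdf.IsUniform (X i) K P volume) (hindep : iIndepFun X P) :
    Integrable (fun ω => (numHoles (d + 1) (pointSet fun i => X i ω) : ℝ)) P ∧
      ∫ ω, (numHoles (d + 1) (pointSet fun i => X i ω) : ℝ) ∂P ≤
        2 ^ (d - 1) * (d.factorial : ℝ) * (n.choose d : ℝ) := by
  have hKm : MeasurableSet K := hK.isCompact.isClosed.measurableSet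
  have hX : ∀ i, AEMeasurable (X i) P := fun i =>
    (hunif i).aemeasurable (by simp [hvol]) (by simp [hvol])
  have : IsProbabilityMeasure (volume.restrict K) := ⟨by simp [hvol]⟩
  have : Nonempty (Fin d) := ⟨⟨0, by omega⟩⟩
  have hmap : P.map (fun ω i => X i ω) = Measure.pi fun _ : Fin n => volume.restrict K := by
    rw [(iIndepFun_iff_map_fun_eq_pi_map hX).1 hindep]
    congr 1
    funext i
    rw [hunif i, ProbabilityTheory.cond, hvol, inv_one, one_smul]
  have hXm : AEMeasurable (fun ω i => X i ω) P := aemeasurable_pi_lambda _ hX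
  have hmeas : AEMeasurable (fun x : Fin n → EuclideanSpace ℝ (Fin d) =>
      (numHoles (d + 1) (pointSet x) : ℝ)) (Measure.pi fun _ => volume.restrict K) :=
    aemeasurable_numHoles_pointSet _ ae_injective
  have hle := lintegral_numHoles_le (n := n) (by omega) hK.convex hKm hvol
  have hle' : ∫⁻ x, ENNReal.ofReal (numHoles (d + 1) (pointSet x) : ℝ)
      ∂(Measure.pi fun _ : Fin n => volume.restrict K) ≤
      ENNReal.ofReal (2 ^ (d - 1) * d.factorial * n.choose d) := by
    simpa only [ENNReal.ofReal_natCast] using hle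
  have hint : Integrable (fun x : Fin n → EuclideanSpace ℝ (Fin d) =>
      (numHoles (d + 1) (pointSet x) : ℝ)) (Measure.pi fun _ => volume.restrict K) := by
    refine ⟨hmeas.aestronglyMeasurable, ?_⟩
    rw [hasFiniteIntegral_iff_ofReal (Filter.Eventually.of_forall fun x => Nat.cast_nonneg _)]
    exact hle'.trans_lt ENNReal.ofReal_lt_top
  rw [← hmap] at hint hle'
  refine ⟨hint.comp_aemeasurable hXm, ?_⟩
  rw [← integral_map hXm (f := fun x : Fin n → EuclideanSpace ℝ (Fin d) =>
    (numHoles (d + 1) (pointSet x) : ℝ)) hint.aestronglyMeasurable,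
    integral_eq_lintegral_of_nonneg_ae (Filter.Eventually.of_forall fun x => Nat.cast_nonneg _)
      hint.aestronglyMeasurable]
  exact ENNReal.toReal_le_of_le_ofReal (by positivity) hle'
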